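/- Let $\mathbf{a}$ be a Turing degree that contains a computably enumerable (c.e.) set and is not low, i.e. $\mathbf{a}' \neq \mathbf{0}'$, where $'$ denotes the Turing jump. Then $\mathbf{a}$ contains a c.e. set $A \subseteq \mathbb{N}$ of asymptotic density $\frac12$, i.e. $$\lim_{n \to \infty} \frac{|A \cap \{0, 1, \dots, n-1\}|}{n} = \frac12,$$ such that $A$ is not coarsely computable: there is no computable set $C \subseteq \mathbb{N}$ such that $\{n \in \mathbb{N} : n \in A \Leftrightarrow n \in C\}$ has asymptotic density $1$. -/

import Mathlib

open Filter Topology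

/-- The characteristic function of a set of natural numbers, as a (total) oracle. -/
noncomputable def charFun (X : Set ℕ) : ℕ →. ℕ :=
  fun n => Part.some (X.indicator 1 n)

/-- The Turing degree of a set of natural numbers. -/
noncomputable def turingDegreeOf (X : Set ℕ) : TuringDegree :=
  toAntisymmetrization TuringReducible (charFun X)

/-- Computably enumerable sets of natural numbers. -/
def IsCESet (X : Set ℕ) : Prop := REPred fun n => n ∈ X

/-- Computable sets of natural numbers. -/
def IsComputableSet (X : Set ℕ) : Prop := ComputablePred fun n => n ∈ X

open Classical in
/-- The initial segment of (the characteristic function of) `X` of length `k`. -/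
noncomputable def initialSegment (X : Set ℕ) (k : ℕ) : List Bool :=
  (List.range k).map fun j => decide (j ∈ X)

/-- The `e`-th set `W_e^X` that is computably enumerable in `X`, i.e. the domain of the `e`-th
Turing functional with oracle `X`. A Turing functional is presented, as usual, by the c.e. set of
pairs `(n, σ)` such that the computation with input `n` halts when its oracle queries are answered
by the finite string `σ`; here this c.e. set is the domain of the `e`-th partial computable
function. Then `n ∈ W_e^X` iff the computation halts with some initial segment of `X` as oracle. -/
def oracleCESet (X : Set ℕ) (e : ℕ) : Set ℕ :=
  {n | ∃ k : ℕ, ((Denumerable.ofNat Nat.Partrec.Code e).eval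
    (Encodable.encode (n, initialSegment X k))).Dom}

/-- The Turing jump `X' = {e | e ∈ W_e^X}`. -/
def turingJump (X : Set ℕ) : Set ℕ := {e | e ∈ oracleCESet X e}

/-- A set is low if its jump is Turing equivalent to the jump of the empty set. -/
def IsLowSet (X : Set ℕ) : Prop :=
  turingDegreeOf (turingJump X) = turingDegreeOf (turingJump ∅)

/-- A Turing degree is c.e. if it contains a c.e. set. -/
def IsCEDegree (a : TuringDegree) : Prop :=
  ∃ X : Set ℕ, turingDegreeOf X = a ∧ IsCESet X

/-- A Turing degree is low if it contains a low set. (The degree of the jump of a set depends only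
on the degree of the set, so that then every set in the degree is low.) -/
def IsLowDegree (a : TuringDegree) : Prop :=
  ∃ X : Set ℕ, turingDegreeOf X = a ∧ IsLowSet X

/-- The set `A` has asymptotic density `r`: `|A ∩ {0, …, n - 1}| / n` tends to `r`. -/
def HasAsymptoticDensity (A : Set ℕ) (r : ℝ) : Prop :=
  Tendsto (fun n : ℕ => ((A ∩ Set.Iio n).ncard : ℝ) / n) atTop (𝓝 r)

/-- `A` is coarsely computable if some computable set `C` agrees with `A` on a set of asymptotic
density `1`. -/
def IsCoarselyComputable (A : Set ℕ) : Prop :=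
  ∃ C : Set ℕ, IsComputableSet C ∧ HasAsymptoticDensity {n | n ∈ A ↔ n ∈ C} 1

/-!
Let `C` be a c.e. set whose degree is not low. The set `A` contains at most one of `2 k` and
`2 k + 1`. Every `k` carries a restraint, a finite set of numbers to be kept out of `C`, and one of
`2 k` and `2 k + 1` enters `A` exactly when `C` violates this restraint, namely the one on which `A`
then differs at `2 k` from the set computed by a program `e`. Here `k = 2 ^ j (2 r + 1)` with
`j = ⟨e, i⟩`; the numbers with `r = 0` carry `{j}` and code `C` into `A`, and those with
`2 ^ s ≤ r < 2 ^ (s + 1)` carry the use of a computation that puts `i` into the jump of `C` and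
appears at stage `s`. All the remaining information in `A` can be recovered from `C`.

For each `i` only finitely many of these restraints are never violated, because the true
computation, once found, is not abandoned; so the `k` that are never released have density `0` and
`A` has density `1 / 2`. If program `e` computes a set coarsely equal to `A`, it converges on the
inputs below `4 ^ s` by a computable stage `h s`. A restraint violated after that stage makes the
set disagree with `A` on a whole block `2 ^ s ≤ r < 2 ^ (s + 1)`, a positive fraction of the numbers
below its end, so for each `i` this happens for only finitely many `s`. But then whether a restraint
still looks respected at stage `h s` is a correct guess in the limit, so the jump of `C` is limit
computable and `C` is low.
-/

open Encodable Denumerable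
open Nat.Partrec (Code)

section ComputableFunctions

theorem computable_unpair_fst : Computable fun n : ℕ => n.unpair.1 :=
  Computable.fst.comp Computable.unpair

theorem computable_unpair_snd : Computable fun n : ℕ => n.unpair.2 :=
  Computable.snd.comp Computable.unpair

theorem primrec₂_pow : Primrec₂ ((· ^ ·) : ℕ → ℕ → ℕ) :=
  Primrec₂.unpaired'.1 Nat.Primrec.pow

theorem primrec_padicValNat (p : ℕ) [Fact p.Prime] : Primrec (padicValNat p) := by
  have hdvd : PrimrecRel fun k j : ℕ => p ^ j ∣ k :=
    (Primrec.eq.comp (Primrec.nat_mod.comp Primrec.fst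
      (primrec₂_pow.comp (Primrec.const p) Primrec.snd)) (Primrec.const 0)).of_eq
      fun _ => (Nat.dvd_iff_mod_eq_zero ..).symm
  refine (Primrec.nat_findGreatest Primrec.id hdvd).of_eq fun k => ?_
  rcases eq_or_ne k 0 with rfl | hk
  · simp
  · refine Nat.findGreatest_eq_iff.2 ⟨?_, fun _ => pow_padicValNat_dvd, fun j hj _ hdvd => ?_⟩
    · exact (Nat.lt_pow_self (Fact.out : p.Prime).one_lt).le.trans
        (Nat.le_of_dvd (Nat.pos_of_ne_zero hk) pow_padicValNat_dvd)
    · exact hj.not_ge ((padicValNat_dvd_iff_le hk).1 hdvd)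

theorem primrec_log {b : ℕ} (hb : 1 < b) : Primrec (Nat.log b) := by
  have hle : PrimrecRel fun n j : ℕ => b ^ j ≤ n :=
    Primrec.nat_le.comp (primrec₂_pow.comp (Primrec.const b) Primrec.snd) Primrec.fst
  refine (Primrec.nat_findGreatest Primrec.id hle).of_eq fun n => Nat.findGreatest_eq_iff.2 ?_
  refine ⟨Nat.log_le_self b n, fun hn => Nat.pow_log_le_self b ?_, fun j hj _ => ?_⟩
  · rintro rfl
    simp at hn
  · exact (Nat.lt_pow_of_log_lt hb hj).not_ge

theorem computablePred_primrecRel_comp {α β γ : Type*} [Primcodable α] [Primcodable β]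
    [Primcodable γ] {R : β → γ → Prop} {f : α → β} {g : α → γ} (hR : PrimrecRel R)
    (hf : Computable f) (hg : Computable g) : ComputablePred fun a => R (f a) (g a) :=
  ComputablePred.computable_of_manyOneReducible
    ⟨fun a => (f a, g a), hf.pair hg, fun _ => Iff.rfl⟩ hR.computablePred

theorem rePred_exists_nat {α : Type*} [Primcodable α] {p : α → ℕ → Prop}
    (hp : ComputablePred fun q : α × ℕ => p q.1 q.2) : REPred fun a => ∃ n, p a n := by
  classical
  have hdec : Computable₂ fun a n => decide (p a n) := hp.decide
  refine (Partrec.rfind hdec.partrec₂).dom_re.of_eq fun a => ?_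
  rw [Nat.rfind_dom]
  simp

theorem exists_convergence_bound {c : Code} (hc : ∀ x, (c.eval x).Dom) :
    ∃ h : ℕ → ℕ, Computable h ∧ Monotone h ∧ (∀ n, n ≤ h n) ∧
      ∀ n, ∀ x < n, (c.evaln (h n) x).isSome := by
  have hconv : ∀ n, ∃ t, n ≤ t ∧ ∀ x < n, (c.evaln t x).isSome := fun n => by
    refine ((eventually_ge_atTop n).and ((Filter.eventually_all_finite (Set.finite_Iio n)).2
      fun x _ => ?_)).exists
    obtain ⟨y, hy⟩ := Part.dom_iff_mem.1 (hc x)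
    obtain ⟨t, ht⟩ := Code.evaln_complete.1 hy
    filter_upwards [eventually_ge_atTop t] with u hu
    exact Option.isSome_of_mem (Code.evaln_mono hu ht)
  have hisSome : PrimrecRel fun x t : ℕ => (c.evaln t x).isSome :=
    ⟨inferInstance, (Primrec.option_isSome.comp (Code.primrec_evaln.comp
      ((Primrec.snd.pair (Primrec.const c)).pair Primrec.fst))).of_eq fun _ => by simp⟩
  have hcond : PrimrecRel fun n t => n ≤ t ∧ ∀ x < n, (c.evaln t x).isSome :=
    PrimrecPred.and Primrec.nat_le hisSome.forall_lt
  refine ⟨fun n => Nat.find (hconv n), Computable.find hcond.computablePred hconv,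
    fun n m hnm => Nat.find_min' _ ?_, fun n => (Nat.find_spec (hconv n)).1,
    fun n => (Nat.find_spec (hconv n)).2⟩
  obtain ⟨hm, hsome⟩ := Nat.find_spec (hconv m)
  exact ⟨hnm.trans hm, fun x hx => hsome x (hx.trans_le hnm)⟩

theorem IsComputableSet.exists_code {D : Set ℕ} (hD : IsComputableSet D) :
    ∃ c : Code, (∀ x, (c.eval x).Dom) ∧ ∀ t x, (c.evaln t x).isSome →
      (c.evaln t x = some 1 ↔ x ∈ D) := by
  classical
  obtain ⟨c, hc⟩ := Code.exists_code.1 (Partrec.nat_iff.1 (Computable.cond hD.decide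
    (Computable.const 1) (Computable.const 0)).partrec)
  refine ⟨c, fun x => by simp [hc], fun t x hsome => ?_⟩
  obtain ⟨y, hy⟩ := Option.isSome_iff_exists.1 hsome
  have hval := Code.evaln_sound hy
  rw [hc] at hval
  by_cases hx : x ∈ D <;> simp_all

end ComputableFunctions

section OracleComputation

variable {O : Set (ℕ →. ℕ)} {f g : ℕ → ℕ}

theorem computableIn_comp (hf : ComputableIn O f) (hg : ComputableIn O g) :
    ComputableIn O fun n => f (g n) :=
  RecursiveIn.iff_nat.2 ((Nat.RecursiveIn.comp (RecursiveIn.iff_nat.1 hf)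
    (RecursiveIn.iff_nat.1 hg)).of_eq fun n => by simp)

theorem computableIn_pair (hf : ComputableIn O f) (hg : ComputableIn O g) :
    ComputableIn O fun n => Nat.pair (f n) (g n) :=
  RecursiveIn.iff_nat.2 ((Nat.RecursiveIn.pair (RecursiveIn.iff_nat.1 hf)
    (RecursiveIn.iff_nat.1 hg)).of_eq fun n => by simp [Seq.seq])

theorem computableIn_of_succ (hf : ComputableIn O f) (hg : ∀ k, g (k + 1) = f (Nat.pair k (g k))) :
    ComputableIn O g := by
  have hstep : ComputableIn O fun p : ℕ => f p.unpair.2 :=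
    computableIn_comp hf computable_unpair_snd.computableIn
  have hprec := Nat.RecursiveIn.prec
    (RecursiveIn.iff_nat.1 (ComputableIn.const (O := O) (α := ℕ) (g 0)))
    (RecursiveIn.iff_nat.1 hstep)
  have hzero : ComputableIn O fun n : ℕ => Nat.pair 0 n :=
    computableIn_pair (ComputableIn.const 0) ComputableIn.id
  refine RecursiveIn.iff_nat.2
    ((Nat.RecursiveIn.comp hprec (RecursiveIn.iff_nat.1 hzero)).of_eq fun n => ?_)
  simp only [Part.bind_eq_bind, Part.bind_some, Nat.unpair_pair]
  induction n with
  | zero => rfl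
  | succ n ih => exact (congrArg (fun p : Part ℕ => p.bind _) ih).trans (by simp [hg])

theorem exists_computableIn_search {P : ℕ → Prop} (hP : ComputablePred P) (hf : ComputableIn O f)
    (hsearch : ∀ n, ∃ m, P (f (Nat.pair n m))) :
    ∃ g : ℕ → ℕ, ComputableIn O g ∧ ∀ n, P (f (Nat.pair n (g n))) := by
  classical
  have htest : Computable fun q => if P q then 0 else 1 :=
    ComputablePred.ite (Computable.const 0) (Computable.const 1) hP
  refine ⟨fun n => Nat.find (hsearch n), RecursiveIn.iff_nat.2 ((Nat.RecursiveIn.rfind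
    (RecursiveIn.iff_nat.1 (computableIn_comp htest.computableIn hf))).of_eq_tot fun n =>
      Nat.mem_rfind.2 ⟨?_, fun hm => ?_⟩), fun n => Nat.find_spec (hsearch n)⟩
  · simpa using Nat.find_spec (hsearch n)
  · simpa using Nat.find_min (hsearch n) hm

open Classical in
theorem initialSegment_succ (X : Set ℕ) (k : ℕ) :
    initialSegment X (k + 1) = initialSegment X k ++ [decide (k ∈ X)] := by
  simp [initialSegment, List.range_succ]

theorem getElem?_initialSegment_eq_false {X : Set ℕ} {k n : ℕ} :
    (initialSegment X k)[n]? = some false ↔ n < k ∧ n ∉ X := by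
  by_cases hn : n < k <;> simp [initialSegment, hn]

theorem computableIn_initialSegment (X : Set ℕ) :
    ComputableIn {charFun X} fun k => encode (initialSegment X k) := by
  have hX : ComputableIn {charFun X} (X.indicator 1 : ℕ → ℕ) := RecursiveIn.oracle _ rfl
  let push : ℕ → ℕ := fun q =>
    encode ((decode (α := List Bool) q.unpair.1).getD [] ++ [q.unpair.2 == 1])
  have hpush : Computable push :=
    Computable.encode.comp (Computable.list_append.comp
      (Computable.option_getD (Computable.decode.comp computable_unpair_fst) (Computable.const []))
      (Computable.list_cons.comp (Primrec.beq.to_comp.comp computable_unpair_snd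
        (Computable.const 1)) (Computable.const [])))
  have hstep : ComputableIn {charFun X} fun p : ℕ =>
      push (Nat.pair p.unpair.2 (X.indicator 1 p.unpair.1)) :=
    computableIn_comp hpush.computableIn (computableIn_pair computable_unpair_snd.computableIn
      (computableIn_comp hX computable_unpair_fst.computableIn))
  refine computableIn_of_succ hstep fun k => ?_
  by_cases hk : k ∈ X <;> simp [push, initialSegment_succ, hk]

end OracleComputation

/-- A restraint: a finite list of numbers that are to stay outside some set; `none` is a restraint
that nothing respects. -/
abbrev Restraint := Option (List ℕ)

namespace Restraint

/-- The restraint `r` is present and respected by `Z`. -/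
def IsRespectedBy (r : Restraint) (Z : Set ℕ) : Prop := ∃ l ∈ r, ∀ x ∈ l, x ∉ Z

variable {r : Restraint} {l : List ℕ} {Y Z : Set ℕ}

@[simp] theorem not_isRespectedBy_none : ¬ IsRespectedBy none Z := by simp [IsRespectedBy]

@[simp] theorem isRespectedBy_some : IsRespectedBy (some l) Z ↔ ∀ x ∈ l, x ∉ Z := by
  simp [IsRespectedBy]

theorem IsRespectedBy.anti (hYZ : Y ⊆ Z) (h : r.IsRespectedBy Z) : r.IsRespectedBy Y :=
  h.imp fun _ hl => ⟨hl.1, fun x hx hxY => hl.2 x hx (hYZ hxY)⟩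

theorem primrecRel_isRespectedBy {α : Type*} [Primcodable α] {Z : α → Set ℕ}
    (hZ : PrimrecRel fun a x => x ∈ Z a) :
    PrimrecRel fun (r : Restraint) a => r.IsRespectedBy (Z a) :=
  (hZ.swap.not.forall_mem_list.exists_mem_list.comp (Primrec.optionToList.comp Primrec.fst)
    Primrec.snd).of_eq fun _ => by simp [IsRespectedBy]

end Restraint

/-- `X` is enumeration reducible to the complement of `Y`: a computable list of axioms, each a
restraint on `Y`, puts `n` into `X` as soon as `Y` respects one of the axioms for `n`. -/
def IsEnumerableFromCompl (X Y : Set ℕ) : Prop :=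
  ∃ f : ℕ → ℕ → Restraint, Computable₂ f ∧ ∀ n, n ∈ X ↔ ∃ s, (f n s).IsRespectedBy Y

section EnumerationReducibility

variable {X Y : Set ℕ}

theorem isRespectedBy_iff_exists_initialSegment {r : Restraint} :
    r.IsRespectedBy Y ↔ ∃ k, r.IsRespectedBy {x | (initialSegment Y k)[x]? ≠ some false} := by
  constructor
  · rintro ⟨l, hl, hlY⟩
    refine ⟨l.sum + 1, l, hl, fun x hx => not_not.2 ?_⟩
    exact getElem?_initialSegment_eq_false.2
      ⟨Nat.lt_succ_of_le (List.le_sum_of_mem hx), hlY x hx⟩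
  · rintro ⟨k, hk⟩
    exact hk.anti fun x hx => fun h => (getElem?_initialSegment_eq_false.1 h).2 hx

theorem primrecRel_isRespectedBy_zeros :
    PrimrecRel fun (r : Restraint) (σ : List Bool) =>
      r.IsRespectedBy {x | σ[x]? ≠ some false} :=
  Restraint.primrecRel_isRespectedBy
    (Primrec.eq.comp (Primrec.list_getElem?.comp Primrec.fst Primrec.snd)
      (Primrec.const (some false))).not

theorem exists_computablePred_isRespectedBy_zeros {a : ℕ → ℕ → Restraint} (ha : Computable₂ a) :
    ∃ P : ℕ → Prop, ComputablePred P ∧ ∀ n m k (σ : List Bool),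
      P (Nat.pair (Nat.pair n (Nat.pair m k)) (encode σ)) ↔
        (a n m).IsRespectedBy {x | σ[x]? ≠ some false} := by
  have hrestraint : Computable fun q : ℕ =>
      a q.unpair.1.unpair.1 q.unpair.1.unpair.2.unpair.1 :=
    ha.comp (computable_unpair_fst.comp computable_unpair_fst) (computable_unpair_fst.comp
      (computable_unpair_snd.comp computable_unpair_fst))
  have hstring : Computable fun q : ℕ => (decode (α := List Bool) q.unpair.2).getD [] :=
    Computable.option_getD (Computable.decode.comp computable_unpair_snd) (Computable.const [])
  refine ⟨_, computablePred_primrecRel_comp primrecRel_isRespectedBy_zeros hrestraint hstring,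
    fun n m k σ => ?_⟩
  simp only [Nat.unpair_pair, encodek, Option.getD_some]

theorem exists_computableIn_isRespectedBy {a : ℕ → ℕ → Restraint} (ha : Computable₂ a)
    (htotal : ∀ n, ∃ m, (a n m).IsRespectedBy Y) :
    ∃ g : ℕ → ℕ, ComputableIn {charFun Y} g ∧ ∀ n, (a n (g n)).IsRespectedBy Y := by
  obtain ⟨P, hP, hPiff⟩ := exists_computablePred_isRespectedBy_zeros ha
  have hsegment : ComputableIn {charFun Y} fun p : ℕ =>
      encode (initialSegment Y p.unpair.2.unpair.2) :=
    computableIn_comp (f := fun k => encode (initialSegment Y k)) (computableIn_initialSegment Y)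
      (computable_unpair_snd.comp computable_unpair_snd).computableIn
  have hsearch : ∀ n, ∃ p, P (Nat.pair (id (Nat.pair n p))
      (encode (initialSegment Y (Nat.pair n p).unpair.2.unpair.2))) := fun n => by
    obtain ⟨m, hm⟩ := htotal n
    obtain ⟨k, hk⟩ := isRespectedBy_iff_exists_initialSegment.1 hm
    exact ⟨Nat.pair m k, by simpa only [id_eq, Nat.unpair_pair, hPiff] using hk⟩
  obtain ⟨g, hg, hgP⟩ :=
    exists_computableIn_search hP (computableIn_pair ComputableIn.id hsegment) hsearch
  refine ⟨fun n => (g n).unpair.1, computableIn_comp computable_unpair_fst.computableIn hg,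
    fun n => isRespectedBy_iff_exists_initialSegment.2 ⟨(g n).unpair.2, ?_⟩⟩
  have hn := hgP n
  rw [← Nat.pair_unpair (g n)] at hn
  simpa only [id_eq, Nat.unpair_pair, hPiff] using hn

theorem charFun_reducible_of_isEnumerableFromCompl (hX : IsEnumerableFromCompl X Y)
    (hXc : IsEnumerableFromCompl Xᶜ Y) : TuringReducible (charFun X) (charFun Y) := by
  classical
  obtain ⟨f, hf, hfX⟩ := hX
  obtain ⟨f', hf', hfX'⟩ := hXc
  let a : ℕ → ℕ → Restraint := fun n m =>
    bif m.unpair.1 == 0 then f' n m.unpair.2 else f n m.unpair.2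
  have ha : Computable₂ a := Computable.cond
    (Primrec.beq.to_comp.comp (computable_unpair_fst.comp Computable.snd) (Computable.const 0))
    (hf'.comp Computable.fst (computable_unpair_snd.comp Computable.snd))
    (hf.comp Computable.fst (computable_unpair_snd.comp Computable.snd))
  obtain ⟨g, hg, hga⟩ := exists_computableIn_isRespectedBy (Y := Y) ha fun n => by
    by_cases hn : n ∈ X
    · obtain ⟨s, hs⟩ := (hfX n).1 hn
      exact ⟨Nat.pair 1 s, by simpa [a] using hs⟩
    · obtain ⟨s, hs⟩ := (hfX' n).1 hn
      exact ⟨Nat.pair 0 s, by simpa [a] using hs⟩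
  have hvalue : Computable fun m : ℕ => bif m.unpair.1 == 0 then (0 : ℕ) else 1 := Computable.cond
    (Primrec.beq.to_comp.comp computable_unpair_fst (Computable.const 0))
    (Computable.const 0) (Computable.const 1)
  refine (computableIn_comp hvalue.computableIn hg).of_eq fun n => ?_
  have hn := hga n
  cases hz : (g n).unpair.1 == 0
  · have : n ∈ X := (hfX n).2 ⟨_, by simpa [a, hz] using hn⟩
    simp [charFun, this, hz]
  · have : n ∉ X := (hfX' n).2 ⟨_, by simpa [a, hz] using hn⟩
    simp [charFun, this, hz]

end EnumerationReducibility

/-- An enumeration of the c.e. set `S` in finitely decidable stages that increase to `S`. -/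
structure StageEnumeration {α : Type*} [Primcodable α] (S : Set α) where
  stage : ℕ → Set α
  primrec : PrimrecRel fun t x => x ∈ stage t
  mono : Monotone stage
  mem_iff {x : α} : x ∈ S ↔ ∃ t, x ∈ stage t

theorem nonempty_stageEnumeration {α : Type*} [Primcodable α] {S : Set α}
    (hS : REPred fun x => x ∈ S) : Nonempty (StageEnumeration S) := by
  obtain ⟨c, hc⟩ := Code.exists_code.1 hS
  refine ⟨fun t => {x | (c.evaln t (encode x)).isSome}, ⟨inferInstance, ?_⟩,
    fun t u htu x hx => ?_, fun {x} => ?_⟩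
  · exact (Primrec.option_isSome.comp (Code.primrec_evaln.comp ((Primrec.fst.pair
      (Primrec.const c)).pair (Primrec.encode.comp Primrec.snd)))).of_eq fun _ => by simp
  · obtain ⟨y, hy⟩ := Option.isSome_iff_exists.1 hx
    exact Option.isSome_of_mem (Code.evaln_mono htu hy)
  · have hdom : x ∈ S ↔ (c.eval (encode x)).Dom := by simp [hc, Part.assert]
    rw [hdom, Part.dom_iff_mem]
    simp only [Code.evaln_complete, Set.mem_ofPred_eq, Option.isSome_iff_exists, Option.mem_def]
    exact exists_comm

namespace StageEnumeration

variable {α : Type*} [Primcodable α] {S : Set α}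

theorem stage_subset (E : StageEnumeration S) (t : ℕ) : E.stage t ⊆ S :=
  fun _ hx => E.mem_iff.2 ⟨t, hx⟩

theorem eventually_mem_stage (E : StageEnumeration S) {x : α} (hx : x ∈ S) :
    ∀ᶠ t in atTop, x ∈ E.stage t := by
  obtain ⟨t, ht⟩ := E.mem_iff.1 hx
  filter_upwards [eventually_ge_atTop t] with u hu using E.mono hu ht

theorem isRespectedBy_iff {C : Set ℕ} (E : StageEnumeration C) {r : Restraint} :
    r.IsRespectedBy C ↔ ∀ t, r.IsRespectedBy (E.stage t) := by
  refine ⟨fun h t => h.anti (E.stage_subset t), fun h => ?_⟩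
  obtain ⟨l, hl, -⟩ := h 0
  refine ⟨l, hl, fun x hx hxC => ?_⟩
  obtain ⟨t, ht⟩ := E.mem_iff.1 hxC
  obtain ⟨l', hl', hlt⟩ := h t
  exact hlt x (Option.mem_unique hl' hl ▸ hx) ht

end StageEnumeration

section JumpReducibility

variable {X Y : Set ℕ}

theorem IsCESet.isEnumerableFromCompl (hX : IsCESet X) (Y : Set ℕ) :
    IsEnumerableFromCompl X Y := by
  classical
  obtain ⟨E⟩ := nonempty_stageEnumeration hX
  refine ⟨fun n s => if n ∈ E.stage s then some [] else none, ?_, fun n => ?_⟩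
  · exact (Primrec.ite E.primrec.swap (Primrec.const _) (Primrec.const _)).to_comp
  · rw [E.mem_iff]
    refine exists_congr fun s => ?_
    by_cases hs : n ∈ E.stage s <;> simp [hs]

theorem isEnumerableFromCompl_compl {r : ℕ → ℕ} (hr : Computable r) (hX : ∀ n, n ∈ X ↔ r n ∈ Y) :
    IsEnumerableFromCompl Xᶜ Y :=
  ⟨fun n _ => some [r n], Computable.option_some.comp (Computable.list_cons.comp
    (hr.comp Computable.fst) (Computable.const [])), fun n => by simp [hX]⟩

theorem exists_manyOne_turingJump (X : Set ℕ) {W : Set ℕ} (hW : IsCESet W) :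
    ∃ r : ℕ → ℕ, Computable r ∧ ∀ n, n ∈ W ↔ r n ∈ turingJump X := by
  have hf : Partrec fun p : ℕ => (Part.assert (p.unpair.1 ∈ W) fun _ => Part.some ()).map
      fun _ => 0 :=
    ((show Partrec _ from hW).comp computable_unpair_fst).map (Computable.const 0).to₂
  obtain ⟨c, hc⟩ := Code.exists_code.1 (Partrec.nat_iff.1 hf)
  refine ⟨fun n => encode (c.curry n), ?_, fun n => ?_⟩
  · exact Computable.encode.comp
      (Code.primrec₂_curry.to_comp.comp (Computable.const c) Computable.id)
  · simp [turingJump, oracleCESet, Code.eval_curry, hc, Part.assert]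

/-- The c.e. set of pairs `(i, σ)` such that the `i`-th functional halts on input `i` with the
answers `σ`; the jump of `X` is the set of all `i` paired with some initial segment of `X`. -/
def jumpAxioms : Set (ℕ × List Bool) := {q | ((ofNat Code q.1).eval (encode q)).Dom}

theorem mem_turingJump_iff {i : ℕ} :
    i ∈ turingJump X ↔ ∃ k, (i, initialSegment X k) ∈ jumpAxioms := Iff.rfl

theorem rePred_jumpAxioms : REPred fun q => q ∈ jumpAxioms :=
  (Code.eval_part.comp ((Computable.ofNat Code).comp Computable.fst) Computable.encode).dom_re

theorem isCESet_turingJump_empty : IsCESet (turingJump ∅) := by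
  obtain ⟨F⟩ := nonempty_stageEnumeration rePred_jumpAxioms
  have hseg : Computable fun k => initialSegment ∅ k :=
    (Primrec.list_map Primrec.list_range (Primrec.const false).to₂).to_comp.of_eq fun k => by
      simp [initialSegment]
  refine (rePred_exists_nat (p := fun i n =>
    (i, initialSegment ∅ n.unpair.2) ∈ F.stage n.unpair.1) ?_).of_eq fun i => ?_
  · exact (computablePred_primrecRel_comp F.primrec
      (computable_unpair_fst.comp Computable.snd)
      (Computable.fst.pair (hseg.comp (computable_unpair_snd.comp Computable.snd))) :)
  · rw [mem_turingJump_iff]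
    simp only [F.mem_iff]
    constructor
    · rintro ⟨n, hn⟩
      exact ⟨n.unpair.2, n.unpair.1, hn⟩
    · rintro ⟨k, t, h⟩
      exact ⟨Nat.pair t k, by simpa using h⟩

theorem turingJump_empty_reducible (X : Set ℕ) :
    TuringReducible (charFun (turingJump ∅)) (charFun (turingJump X)) := by
  obtain ⟨r, hr, hiff⟩ := exists_manyOne_turingJump X isCESet_turingJump_empty
  exact charFun_reducible_of_isEnumerableFromCompl
    (isCESet_turingJump_empty.isEnumerableFromCompl _) (isEnumerableFromCompl_compl hr hiff)

theorem isEnumerableFromCompl_of_limit (Y : Set ℕ) {g : ℕ → ℕ → Bool} (hg : Computable₂ g)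
    (hlim : ∀ n, ∀ᶠ s in atTop, (g n s = true ↔ n ∈ X)) :
    IsEnumerableFromCompl X (turingJump Y) := by
  let changes : Set ℕ := {p | ∃ t, p.unpair.2 ≤ t ∧ g p.unpair.1 t ≠ g p.unpair.1 p.unpair.2}
  have hdiffer : PrimrecRel fun (p q : ℕ × Bool) => p.1 ≤ q.1 ∧ q.2 ≠ p.2 :=
    PrimrecPred.and
      (Primrec.nat_le.comp (Primrec.fst.comp Primrec.fst) (Primrec.fst.comp Primrec.snd))
      (Primrec.eq.comp (Primrec.snd.comp Primrec.snd) (Primrec.snd.comp Primrec.fst)).not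
  have hchanges : IsCESet changes := rePred_exists_nat
    (computablePred_primrecRel_comp hdiffer
      ((computable_unpair_snd.comp Computable.fst).pair
        (hg.comp (computable_unpair_fst.comp Computable.fst)
          (computable_unpair_snd.comp Computable.fst)))
      (Computable.snd.pair (hg.comp (computable_unpair_fst.comp Computable.fst) Computable.snd)) :)
  obtain ⟨r, hr, hiff⟩ := exists_manyOne_turingJump Y hchanges
  refine ⟨fun n s => bif g n s then some [r (Nat.pair n s)] else none, ?_, fun n => ?_⟩
  · exact Computable.cond hg (Computable.option_some.comp (Computable.list_cons.comp
      (hr.comp Primrec₂.natPair.to_comp) (Computable.const []))) (Computable.const none)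
  · have hrespected_iff : ∀ s, Restraint.IsRespectedBy
        (bif g n s then some [r (Nat.pair n s)] else none) (turingJump Y) ↔
          g n s = true ∧ ∀ t ≥ s, g n t = g n s := fun s => by
      cases hgs : g n s <;> simp [← hiff, changes, hgs]
    obtain ⟨b, hb⟩ := eventually_atTop.1 (hlim n)
    simp only [hrespected_iff]
    constructor
    · intro hn
      have htrue : ∀ t ≥ b, g n t = true := fun t ht => (hb t ht).2 hn
      exact ⟨b, htrue b le_rfl, fun t ht => (htrue t ht).trans (htrue b le_rfl).symm⟩
    · rintro ⟨s, hs, hst⟩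
      exact (hb _ (le_max_right s b)).1 ((hst _ (le_max_left s b)).trans hs)

theorem turingDegreeOf_eq_iff : turingDegreeOf X = turingDegreeOf Y ↔
    TuringReducible (charFun X) (charFun Y) ∧ TuringReducible (charFun Y) (charFun X) :=
  Quotient.eq

theorem isLowSet_of_limit {g : ℕ → ℕ → Bool} (hg : Computable₂ g)
    (hlim : ∀ n, ∀ᶠ s in atTop, (g n s = true ↔ n ∈ turingJump X)) : IsLowSet X := by
  refine turingDegreeOf_eq_iff.2 ⟨charFun_reducible_of_isEnumerableFromCompl
    (isEnumerableFromCompl_of_limit ∅ hg hlim) (isEnumerableFromCompl_of_limit ∅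
      (g := fun n s => !g n s) (Primrec.not.to_comp.comp hg) fun n => ?_),
    turingJump_empty_reducible X⟩
  filter_upwards [hlim n] with s hs
  simp [← hs]

end JumpReducibility

section Restraints

theorem initialSegment_congr {X Y : Set ℕ} {k : ℕ} (h : ∀ x < k, (x ∈ X ↔ x ∈ Y)) :
    initialSegment X k = initialSegment Y k :=
  List.map_congr_left fun x hx => by simp [h x (List.mem_range.1 hx)]

variable {C : Set ℕ} {S : Set (ℕ × List Bool)}

theorem StageEnumeration.eventually_agree (E : StageEnumeration C) (k : ℕ) :
    ∀ᶠ s in atTop, ∀ x < k, (x ∈ E.stage s ↔ x ∈ C) := by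
  refine (Filter.eventually_all_finite (Set.finite_Iio k)).2 fun x _ => ?_
  by_cases hx : x ∈ C
  · filter_upwards [E.eventually_mem_stage hx] with s hs using iff_of_true hs hx
  · exact .of_forall fun s => iff_of_false (fun hs => hx (E.stage_subset s hs)) hx

open Classical in
/-- The restraint of length `u` on `C` imposed at stage `s`: the numbers below `u` that have not
been enumerated into `C` yet. -/
noncomputable def StageEnumeration.missing (E : StageEnumeration C) (s u : ℕ) : List ℕ :=
  (List.range u).filter (· ∉ E.stage s)

open Classical in
/-- The least `u ≤ s` such that, at stage `s`, `S` contains `i` paired with the string of length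
`u` that is then believed to be an initial segment of `C`: the use of this computation. -/
noncomputable def apparentUse (E : StageEnumeration C) (F : StageEnumeration S) (i s : ℕ) :
    Option ℕ :=
  (List.range (s + 1)).find? fun u => (i, initialSegment (E.stage s) u) ∈ F.stage s

/-- The restraint on `C` that preserves the computation apparent at stage `s`. -/
noncomputable def useRestraint (E : StageEnumeration C) (F : StageEnumeration S) (i s : ℕ) :
    Restraint :=
  (apparentUse E F i s).map (E.missing s)

theorem StageEnumeration.agree_of_isRespectedBy_missing (E : StageEnumeration C) {s u : ℕ}
    (h : Restraint.IsRespectedBy (some (E.missing s u)) C) :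
    ∀ x < u, (x ∈ E.stage s ↔ x ∈ C) := by
  refine fun x hx => ⟨fun hs => E.stage_subset s hs, fun hxC => not_not.1 fun hs => ?_⟩
  exact Restraint.isRespectedBy_some.1 h x (by simp [missing, hx, hs]) hxC

variable {E : StageEnumeration C} {F : StageEnumeration S} {i : ℕ}

theorem exists_mem_of_useRestraint_isRespectedBy {s : ℕ}
    (h : (useRestraint E F i s).IsRespectedBy C) : ∃ k, (i, initialSegment C k) ∈ S := by
  cases hu : apparentUse E F i s with
  | none => simp [useRestraint, hu] at h
  | some u =>
    rw [useRestraint, hu] at h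
    rw [apparentUse, List.find?_range_eq_some] at hu
    refine ⟨u, ?_⟩
    rw [← initialSegment_congr (E.agree_of_isRespectedBy_missing h)]
    exact F.stage_subset s (by simpa using hu.1)

theorem eventually_useRestraint_eq (h : ∃ k, (i, initialSegment C k) ∈ S) :
    ∃ r : Restraint, r.IsRespectedBy C ∧ ∀ᶠ s in atTop, useRestraint E F i s = r := by
  classical
  let u := Nat.find h
  refine ⟨some ((List.range u).filter (· ∉ C)), by simp, ?_⟩
  filter_upwards [E.eventually_agree u, F.eventually_mem_stage (Nat.find_spec h),
    eventually_ge_atTop u] with s hagree hmem hs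
  have hsegment : ∀ k ≤ u, initialSegment (E.stage s) k = initialSegment C k := fun k hk =>
    initialSegment_congr fun x hx => hagree x (hx.trans_le hk)
  have huse : apparentUse E F i s = some u := by
    refine List.find?_range_eq_some.2 ⟨?_, List.mem_range.2 (Nat.lt_succ_of_le hs), fun k hk => ?_⟩
    · simpa [hsegment u le_rfl] using hmem
    · simpa [hsegment k hk.le] using fun hkS => Nat.find_min h hk (F.stage_subset s hkS)
  simp only [useRestraint, huse, Option.map_some, StageEnumeration.missing, Option.some_inj]
  exact List.filter_congr fun x hx => by simp [hagree x (List.mem_range.1 hx)]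

theorem primrec₂_useRestraint (E : StageEnumeration C) (F : StageEnumeration S) :
    Primrec₂ (useRestraint E F) := by
  classical
  have hsegment : Primrec₂ fun s u => initialSegment (E.stage s) u :=
    (Primrec.list_map (Primrec.list_range.comp Primrec.snd)
      (E.primrec.comp (Primrec.fst.comp Primrec.fst) Primrec.snd).decide.to₂).of_eq fun _ => by
        simp [initialSegment]
  have hmem : PrimrecRel fun (u : ℕ) (q : ℕ × ℕ) =>
      (q.1, initialSegment (E.stage q.2) u) ∈ F.stage q.2 :=
    F.primrec.comp (Primrec.snd.comp Primrec.snd) ((Primrec.fst.comp Primrec.snd).pair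
      (hsegment.comp (Primrec.snd.comp Primrec.snd) Primrec.fst))
  have huse : Primrec₂ (apparentUse E F) :=
    (Primrec.list_head?.comp (hmem.listFilter.comp
      (Primrec.list_range.comp (Primrec.succ.comp Primrec.snd)) .id)).of_eq fun _ => by
        simp [apparentUse]
  have hmissing : Primrec₂ E.missing :=
    (E.primrec.swap.not.listFilter.comp (Primrec.list_range.comp Primrec.snd) Primrec.fst).of_eq
      fun _ => by simp [StageEnumeration.missing]
  exact Primrec.option_map huse (hmissing.comp (Primrec.snd.comp Primrec.fst) Primrec.snd)

/-- The restraint `f s`, kept only at the stages `s` at which `f` changes, so that each restraint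
is imposed once rather than at every stage. -/
def Restraint.onChange (f : ℕ → Restraint) (s : ℕ) : Restraint :=
  if s = 0 ∨ f (s - 1) ≠ f s then f s else none

theorem Restraint.exists_onChange_eq (f : ℕ → Restraint) (s : ℕ) :
    ∃ t, Restraint.onChange f t = f s := by
  induction s with
  | zero => exact ⟨0, by simp [onChange]⟩
  | succ s ih =>
    by_cases hs : f s = f (s + 1)
    · rwa [← hs]
    · exact ⟨s + 1, by simp [onChange, hs]⟩

theorem Restraint.isRespectedBy_of_onChange {f : ℕ → Restraint} {s : ℕ}
    (h : (onChange f s).IsRespectedBy C) : (f s).IsRespectedBy C := by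
  rw [onChange] at h
  split_ifs at h
  · exact h
  · exact absurd h not_isRespectedBy_none

theorem Restraint.finite_isRespectedBy_onChange {f : ℕ → Restraint} {r : Restraint}
    (hf : ∀ᶠ s in atTop, f s = r) : {s | (onChange f s).IsRespectedBy C}.Finite := by
  obtain ⟨b, hb⟩ := eventually_atTop.1 hf
  refine (Set.finite_Iic b).subset fun s hs =>
    Set.mem_Iic.2 (le_of_not_gt fun hbs => ?_)
  have hnone : onChange f s = none := if_neg <| by
    rintro (rfl | hne)
    · exact b.not_lt_zero hbs
    · exact hne ((hb _ (Nat.le_pred_of_lt hbs)).trans (hb s hbs.le).symm)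
  exact not_isRespectedBy_none (hnone ▸ hs : Restraint.IsRespectedBy none C)

theorem exists_primrec₂_restraint (hC : IsCESet C) (hS : REPred fun q => q ∈ S) :
    ∃ R : ℕ → ℕ → Restraint, Primrec₂ R ∧
      (∀ i, (∃ k, (i, initialSegment C k) ∈ S) ↔ ∃ s, (R i s).IsRespectedBy C) ∧
      ∀ i, {s | (R i s).IsRespectedBy C}.Finite := by
  obtain ⟨E⟩ := nonempty_stageEnumeration hC
  obtain ⟨F⟩ := nonempty_stageEnumeration hS
  have hprimrec := primrec₂_useRestraint E F
  refine ⟨fun i => Restraint.onChange (useRestraint E F i), ?_, fun i => ⟨fun h => ?_, ?_⟩,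
    fun i => ?_⟩
  · refine Primrec.ite (PrimrecPred.or (Primrec.eq.comp Primrec.snd (Primrec.const 0))
      (Primrec.eq.comp ?_ hprimrec).not) hprimrec (Primrec.const none)
    exact hprimrec.comp Primrec.fst (Primrec.pred.comp Primrec.snd)
  · obtain ⟨r, hr, hlim⟩ := eventually_useRestraint_eq (E := E) (F := F) h
    obtain ⟨s, rfl⟩ := hlim.exists
    obtain ⟨t, ht⟩ := Restraint.exists_onChange_eq (useRestraint E F i) s
    exact ⟨t, by simpa only [ht] using hr⟩
  · rintro ⟨s, hs⟩
    exact exists_mem_of_useRestraint_isRespectedBy (Restraint.isRespectedBy_of_onChange hs)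
  · by_cases h : ∃ k, (i, initialSegment C k) ∈ S
    · obtain ⟨r, -, hlim⟩ := eventually_useRestraint_eq (E := E) (F := F) h
      exact Restraint.finite_isRespectedBy_onChange hlim
    · exact Set.finite_empty.subset fun s hs => h
        (exists_mem_of_useRestraint_isRespectedBy (Restraint.isRespectedBy_of_onChange hs))

/-- The guess at stage `s` is that `i ∈ W` iff some restraint imposed before `s` still looks
respected at stage `h s`. -/
theorem exists_limit_of_eventually_visible {W : Set ℕ} {R : ℕ → ℕ → Restraint} (hR : Primrec₂ R)
    (hW : ∀ i, i ∈ W ↔ ∃ s, (R i s).IsRespectedBy C) (E : StageEnumeration C) {h : ℕ → ℕ}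
    (hh : Computable h) (hmono : Monotone h) (hle : ∀ s, s ≤ h s)
    (hvisible : ∀ i, ∀ᶠ s in atTop,
      (R i s).IsRespectedBy (E.stage (h s)) → (R i s).IsRespectedBy C) :
    ∃ g : ℕ → ℕ → Bool, Computable₂ g ∧ ∀ i, ∀ᶠ s in atTop, (g i s = true ↔ i ∈ W) := by
  classical
  refine ⟨fun i s => decide (∃ t < s, (R i t).IsRespectedBy (E.stage (h s))), ?_, fun i => ?_⟩
  · have hlooks : PrimrecRel fun (t : ℕ) (p : ℕ × ℕ) => (R p.1 t).IsRespectedBy (E.stage p.2) :=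
      (Restraint.primrecRel_isRespectedBy E.primrec).comp
        (hR.comp (Primrec.fst.comp Primrec.snd) Primrec.fst) (Primrec.snd.comp Primrec.snd)
    have hsome := computablePred_primrecRel_comp hlooks.exists_mem_list
      (Primrec.list_range.to_comp.comp Computable.snd)
      (Computable.fst.pair (hh.comp Computable.snd))
    exact (hsome.of_eq fun _ => by simp only [List.mem_range]).decide
  · simp only [decide_eq_true_eq]
    by_cases hi : i ∈ W
    · obtain ⟨t, ht⟩ := (hW i).1 hi
      filter_upwards [eventually_gt_atTop t] with s hs
      exact iff_of_true ⟨t, hs, ht.anti (E.stage_subset _)⟩ hi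
    · have hviolated : ∀ t, ∀ᶠ s in atTop, ¬ (R i t).IsRespectedBy (E.stage s) := fun t => by
        obtain ⟨b, hb⟩ := not_forall.1 (E.isRespectedBy_iff.not.1 fun ht => hi ((hW i).2 ⟨t, ht⟩))
        filter_upwards [eventually_ge_atTop b] with s hs hlooks using hb (hlooks.anti (E.mono hs))
      obtain ⟨b, hb⟩ := eventually_atTop.1 (hvisible i)
      filter_upwards [(Filter.eventually_all_finite (Set.finite_Iio b)).2 fun t _ => hviolated t]
        with s hs
      refine iff_of_false ?_ hi
      rintro ⟨t, hts, hlooks⟩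
      rcases lt_or_ge t b with htb | htb
      · exact hs t htb (hlooks.anti (E.mono (hle s)))
      · exact hi ((hW i).2 ⟨t, hb t htb (hlooks.anti (E.mono (hmono hts.le)))⟩)

end Restraints

section ReleaseSet

variable {C : Set ℕ} {L : ℕ → Restraint} {side : ℕ → ℕ → Bool} {k t : ℕ}

/-- The number `k` is released at stage `t`: this is the first stage of the enumeration of `C` that
violates the restraint `L k`. -/
def IsReleasedAt (E : StageEnumeration C) (L : ℕ → Restraint) (k t : ℕ) : Prop :=
  (∀ s < t, (L k).IsRespectedBy (E.stage s)) ∧ ¬ (L k).IsRespectedBy (E.stage t)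

/-- The set that receives `2 * k` or `2 * k + 1`, according to `side k t`, when `k` is released at
stage `t`, and neither of them when `k` is never released. -/
def releaseSet (E : StageEnumeration C) (L : ℕ → Restraint) (side : ℕ → ℕ → Bool) : Set ℕ :=
  {x | ∃ t, IsReleasedAt E L x.div2 t ∧ side x.div2 t = x.bodd}

variable {E : StageEnumeration C}

theorem exists_isReleasedAt_iff : (∃ t, IsReleasedAt E L k t) ↔ ¬ (L k).IsRespectedBy C := by
  classical
  rw [E.isRespectedBy_iff, not_forall]
  refine ⟨fun ⟨t, ht⟩ => ⟨t, ht.2⟩, fun h => ⟨Nat.find h, fun s hs => ?_, Nat.find_spec h⟩⟩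
  exact not_not.1 (Nat.find_min h hs)

theorem IsReleasedAt.unique {u : ℕ} (ht : IsReleasedAt E L k t) (hu : IsReleasedAt E L k u) :
    t = u :=
  le_antisymm (le_of_not_gt fun h => hu.2 (ht.1 u h)) (le_of_not_gt fun h => ht.2 (hu.1 t h))

theorem IsReleasedAt.bit_mem_releaseSet_iff (ht : IsReleasedAt E L k t) {b : Bool} :
    Nat.bit b k ∈ releaseSet E L side ↔ side k t = b := by
  simp only [releaseSet, Set.mem_ofPred_eq, Nat.div2_bit, Nat.bodd_bit]
  exact ⟨fun ⟨u, hu, hside⟩ => ht.unique hu ▸ hside, fun hside => ⟨t, ht, hside⟩⟩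

theorem exists_bit_mem_releaseSet_iff :
    (∃ b, Nat.bit b k ∈ releaseSet E L side) ↔ ¬ (L k).IsRespectedBy C := by
  rw [← exists_isReleasedAt_iff (E := E)]
  refine ⟨fun ⟨b, t, ht, _⟩ => ⟨t, ?_⟩, fun ⟨t, ht⟩ => ⟨_, ht.bit_mem_releaseSet_iff.2 rfl⟩⟩
  rwa [Nat.div2_bit] at ht

theorem primrecRel_isReleasedAt (E : StageEnumeration C) (hL : Primrec L) :
    PrimrecRel (IsReleasedAt E L) := by
  have hrespected : PrimrecRel fun s k => (L k).IsRespectedBy (E.stage s) :=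
    (Restraint.primrecRel_isRespectedBy E.primrec).comp (hL.comp Primrec.snd) Primrec.fst
  exact PrimrecPred.and hrespected.forall_lt.swap hrespected.swap.not

theorem isCESet_releaseSet (E : StageEnumeration C) (hL : Primrec L) (hside : Primrec₂ side) :
    IsCESet (releaseSet E L side) := by
  have hdiv2 : Primrec fun p : ℕ × ℕ => p.1.div2 := Primrec.nat_div2.comp Primrec.fst
  exact rePred_exists_nat (PrimrecPred.computablePred (PrimrecPred.and
    ((primrecRel_isReleasedAt E hL).comp hdiv2 Primrec.snd)
    (Primrec.eq.comp (hside.comp hdiv2 Primrec.snd) (Primrec.nat_bodd.comp Primrec.fst))))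

theorem isEnumerableFromCompl_compl_releaseSet (E : StageEnumeration C) (hL : Primrec L)
    (hside : Primrec₂ side) : IsEnumerableFromCompl (releaseSet E L side)ᶜ C := by
  classical
  have hdiv2 : Primrec fun p : ℕ × ℕ => p.1.div2 := Primrec.nat_div2.comp Primrec.fst
  -- `x` stays out if `x / 2` is released on the other side, or if `C` respects its restraint.
  refine ⟨fun x t => if IsReleasedAt E L x.div2 t
    then (if side x.div2 t = x.bodd then none else some []) else L x.div2, ?_, fun x => ?_⟩
  · exact Primrec.to_comp (Primrec.ite ((primrecRel_isReleasedAt E hL).comp hdiv2 Primrec.snd)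
      (Primrec.ite (Primrec.eq.comp (hside.comp hdiv2 Primrec.snd)
        (Primrec.nat_bodd.comp Primrec.fst)) (Primrec.const _) (Primrec.const _)) (hL.comp hdiv2))
  · rw [← Nat.bit_bodd_div2 x]
    simp only [Nat.div2_bit, Nat.bodd_bit, Set.mem_compl_iff]
    by_cases hx : (L x.div2).IsRespectedBy C
    · have hnever : ∀ t, ¬ IsReleasedAt E L x.div2 t := fun t ht =>
        exists_isReleasedAt_iff.1 ⟨t, ht⟩ hx
      refine iff_of_true (fun hmem => exists_bit_mem_releaseSet_iff.1 ⟨_, hmem⟩ hx) ⟨0, ?_⟩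
      rwa [if_neg (hnever 0)]
    · obtain ⟨t, ht⟩ := exists_isReleasedAt_iff.2 hx
      rw [ht.bit_mem_releaseSet_iff]
      refine ⟨fun hside => ⟨t, by simp [ht, hside]⟩, fun ⟨u, hu⟩ hside => ?_⟩
      by_cases hru : IsReleasedAt E L x.div2 u
      · obtain rfl := hru.unique ht
        simp [hru, hside] at hu
      · exact hx (by rwa [if_neg hru] at hu)

theorem isEnumerableFromCompl_releaseSet {f : ℕ → ℕ} (hf : Computable f)
    (hfL : ∀ j, L (f j) = some [j]) : IsEnumerableFromCompl Cᶜ (releaseSet E L side) := by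
  have hbit : ∀ b, Computable fun p : ℕ × ℕ => Nat.bit b (f p.1)
    | false => Primrec.nat_double.to_comp.comp (hf.comp Computable.fst)
    | true => Primrec.nat_double_succ.to_comp.comp (hf.comp Computable.fst)
  refine ⟨fun j _ => some [Nat.bit false (f j), Nat.bit true (f j)], ?_, fun j => ?_⟩
  · exact Computable.option_some.comp (Computable.list_cons.comp (hbit false)
      (Computable.list_cons.comp (hbit true) (Computable.const [])))
  · have hj : j ∉ C ↔ ¬ ∃ b, Nat.bit b (f j) ∈ releaseSet E L side := by
      rw [exists_bit_mem_releaseSet_iff, hfL, not_not]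
      simp
    rw [Set.mem_compl_iff, hj, Bool.exists_bool]
    simp only [exists_const, Restraint.isRespectedBy_some, List.forall_mem_cons, not_or,
      List.not_mem_nil, IsEmpty.forall_iff, implies_true, and_true]

theorem turingDegreeOf_releaseSet (E : StageEnumeration C) (hC : IsCESet C) (hL : Primrec L)
    (hside : Primrec₂ side) {f : ℕ → ℕ} (hf : Computable f) (hfL : ∀ j, L (f j) = some [j]) :
    turingDegreeOf (releaseSet E L side) = turingDegreeOf C :=
  turingDegreeOf_eq_iff.2
    ⟨charFun_reducible_of_isEnumerableFromCompl
      ((isCESet_releaseSet E hL hside).isEnumerableFromCompl C)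
      (isEnumerableFromCompl_compl_releaseSet E hL hside),
    charFun_reducible_of_isEnumerableFromCompl (hC.isEnumerableFromCompl _)
      (isEnumerableFromCompl_releaseSet hf hfL)⟩

end ReleaseSet

section AsymptoticDensity

variable {A U : Set ℕ}

theorem ncard_inter_Iio_le {d : ℕ} (hd : 0 < d) (hU : {k ∈ U | ¬ d ∣ k}.Finite) (n : ℕ) :
    (U ∩ Set.Iio n).ncard ≤ {k ∈ U | ¬ d ∣ k}.ncard + (n / d + 1) := by
  have hcover : U ∩ Set.Iio n ⊆ {k ∈ U | ¬ d ∣ k} ∪ (d * ·) '' Set.Iio (n / d + 1) := by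
    rintro k ⟨hkU, hkn⟩
    by_cases hdk : d ∣ k
    · obtain ⟨q, rfl⟩ := hdk
      refine Or.inr ⟨q, Nat.lt_succ_of_le ((Nat.le_div_iff_mul_le hd).2 ?_), rfl⟩
      rw [mul_comm]
      exact (Set.mem_Iio.1 hkn).le
    · exact Or.inl ⟨hkU, hdk⟩
  calc (U ∩ Set.Iio n).ncard
      ≤ ({k ∈ U | ¬ d ∣ k} ∪ (d * ·) '' Set.Iio (n / d + 1)).ncard :=
        Set.ncard_le_ncard hcover (hU.union ((Set.finite_Iio _).image _))
    _ ≤ {k ∈ U | ¬ d ∣ k}.ncard + ((d * ·) '' Set.Iio (n / d + 1)).ncard :=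
        Set.ncard_union_le _ _
    _ ≤ {k ∈ U | ¬ d ∣ k}.ncard + (n / d + 1) := by
        gcongr
        exact (Set.ncard_image_le (Set.finite_Iio _)).trans_eq (Set.ncard_Iio_nat _)

theorem hasAsymptoticDensity_zero (hU : ∃ᶠ d in atTop, {k ∈ U | ¬ d ∣ k}.Finite) :
    HasAsymptoticDensity U 0 := by
  refine Metric.tendsto_atTop.2 fun ε hε => ?_
  obtain ⟨d, hfin, hdε⟩ := (hU.and_eventually (eventually_gt_atTop ⌈2 / ε⌉₊)).exists
  set c := {k ∈ U | ¬ d ∣ k}.ncard + 1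
  have hd : 2 / ε < d := Nat.lt_of_ceil_lt hdε
  have hd0 : (0 : ℝ) < d := (by positivity : 0 < 2 / ε).trans hd
  refine ⟨⌈2 * c / ε⌉₊ + 1, fun n hn => ?_⟩
  have hcn : 2 * c / ε < n := Nat.lt_of_ceil_lt hn
  have hn0 : (0 : ℝ) < n := (by positivity : 0 ≤ 2 * c / ε).trans_lt hcn
  have hcount : ((U ∩ Set.Iio n).ncard : ℝ) ≤ n / d + c := by
    have h := ncard_inter_Iio_le (Nat.cast_pos.1 hd0) hfin n
    calc ((U ∩ Set.Iio n).ncard : ℝ) ≤ ((n / d + c : ℕ) : ℝ) := by exact_mod_cast (by lia)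
      _ ≤ n / d + c := by push_cast; gcongr; exact Nat.cast_div_le
  have hnd : (n : ℝ) / d < n * (ε / 2) := by
    rw [div_lt_iff₀ hε] at hd
    rw [div_lt_iff₀ hd0]
    nlinarith
  rw [div_lt_iff₀ hε] at hcn
  rw [dist_zero_right, Real.norm_of_nonneg (by positivity), div_lt_iff₀ hn0]
  linarith

open Classical in
theorem ncard_inter_Iio_eq_count (A : Set ℕ) (n : ℕ) :
    (A ∩ Set.Iio n).ncard = Nat.count (· ∈ A) n := by
  rw [Nat.count_eq_card_filter_range, ← Set.ncard_coe_finset]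
  congr 1
  ext x
  simp [and_comm]

theorem ncard_inter_Iio_two_mul_add (hnone : ∀ k ∈ U, 2 * k ∉ A ∧ 2 * k + 1 ∉ A)
    (hone : ∀ k ∉ U, (2 * k ∈ A ↔ 2 * k + 1 ∉ A)) (m : ℕ) :
    (A ∩ Set.Iio (2 * m)).ncard + (U ∩ Set.Iio m).ncard = m := by
  classical
  simp only [ncard_inter_Iio_eq_count]
  induction m with
  | zero => simp
  | succ m ih =>
    rw [mul_add_one, Nat.count_succ, Nat.count_succ, Nat.count_succ]
    by_cases hm : m ∈ U
    · simp only [hnone m hm, hm, if_true, if_false]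
      lia
    · by_cases hA : 2 * m + 1 ∈ A <;>
        simp only [hone m hm, hm, hA, not_true, not_false_iff, if_true, if_false] <;> lia

theorem ncard_inter_Iio_mono (A : Set ℕ) : Monotone fun n => (A ∩ Set.Iio n).ncard :=
  fun _ n h => Set.ncard_le_ncard (Set.inter_subset_inter_right A (Set.Iio_subset_Iio h))
    ((Set.finite_Iio n).inter_of_right A)

theorem hasAsymptoticDensity_half (hnone : ∀ k ∈ U, 2 * k ∉ A ∧ 2 * k + 1 ∉ A)
    (hone : ∀ k ∉ U, (2 * k ∈ A ↔ 2 * k + 1 ∉ A)) (hU : HasAsymptoticDensity U 0) :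
    HasAsymptoticDensity A (1 / 2) := by
  have herror : ∀ n : ℕ, |((A ∩ Set.Iio n).ncard : ℝ) - n / 2| ≤ (U ∩ Set.Iio n).ncard + 1 := by
    intro n
    have hlower := ncard_inter_Iio_two_mul_add hnone hone (n / 2)
    have hupper := ncard_inter_Iio_two_mul_add hnone hone (n / 2 + 1)
    have hA := ncard_inter_Iio_mono A (by lia : 2 * (n / 2) ≤ n)
    have hA' := ncard_inter_Iio_mono A (by lia : n ≤ 2 * (n / 2 + 1))
    have hUn := ncard_inter_Iio_mono U (Nat.div_le_self n 2)
    beta_reduce at hA hA' hUn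
    have hlower' : n ≤ 2 * ((A ∩ Set.Iio n).ncard + (U ∩ Set.Iio n).ncard + 1) := by lia
    have hupper' : 2 * (A ∩ Set.Iio n).ncard ≤ n + 2 := by lia
    have hlower_cast : (n : ℝ) ≤ 2 * ((A ∩ Set.Iio n).ncard + (U ∩ Set.Iio n).ncard + 1) := by
      exact_mod_cast hlower'
    have hupper_cast : 2 * ((A ∩ Set.Iio n).ncard : ℝ) ≤ n + 2 := by exact_mod_cast hupper'
    rw [abs_le]
    constructor <;> linarith [Nat.cast_nonneg (α := ℝ) (U ∩ Set.Iio n).ncard]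
  have hbound : Tendsto (fun n : ℕ => ((U ∩ Set.Iio n).ncard : ℝ) / n + 1 / n) atTop (𝓝 0) := by
    simpa using hU.add tendsto_one_div_atTop_nhds_zero_nat
  refine tendsto_iff_norm_sub_tendsto_zero.2 (squeeze_zero' (.of_forall fun _ => norm_nonneg _)
    ?_ hbound)
  filter_upwards [eventually_gt_atTop 0] with n hn
  have hn' : (0 : ℝ) < n := Nat.cast_pos.2 hn
  calc ‖((A ∩ Set.Iio n).ncard : ℝ) / n - 1 / 2‖
      = |((A ∩ Set.Iio n).ncard : ℝ) - n / 2| / n := by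
        rw [Real.norm_eq_abs, ← abs_of_pos hn', ← abs_div, abs_of_pos hn']
        congr 1
        field_simp
    _ ≤ ((U ∩ Set.Iio n).ncard + 1) / n := by gcongr; exact herror n
    _ = (U ∩ Set.Iio n).ncard / n + 1 / n := add_div _ _ _

theorem ncard_inter_Iio_add_le {a b m : ℕ} (ha : 0 < a)
    (hA : ∀ r ∈ Set.Ico m (2 * m), a * r + b ∉ A) :
    (A ∩ Set.Iio (a * (2 * m) + b)).ncard + m ≤ a * (2 * m) + b := by
  have hdisj : Disjoint (A ∩ Set.Iio (a * (2 * m) + b)) ((a * · + b) '' Set.Ico m (2 * m)) := by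
    rw [Set.disjoint_right]
    rintro _ ⟨r, hr, rfl⟩ hmem
    exact hA r hr hmem.1
  have hinj : Function.Injective (a * · + b) := fun r r' h => by simpa [ha.ne'] using h
  calc (A ∩ Set.Iio (a * (2 * m) + b)).ncard + m
      = (A ∩ Set.Iio (a * (2 * m) + b) ∪ (a * · + b) '' Set.Ico m (2 * m)).ncard := by
        rw [Set.ncard_union_eq hdisj ((Set.finite_Iio _).inter_of_right A)
          ((Set.finite_Ico _ _).image _), Set.ncard_image_of_injective _ hinj, Set.ncard_Ico_nat,
          two_mul, Nat.add_sub_cancel]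
    _ ≤ (Set.Iio (a * (2 * m) + b)).ncard := by
        refine Set.ncard_le_ncard (Set.union_subset Set.inter_subset_right ?_) (Set.finite_Iio _)
        rintro _ ⟨r, hr, rfl⟩
        exact Nat.add_lt_add_right (Nat.mul_lt_mul_of_pos_left hr.2 ha) b
    _ = a * (2 * m) + b := Set.ncard_Iio_nat _

theorem not_hasAsymptoticDensity_one {a b : ℕ} (ha : 0 < a)
    (hA : ∃ᶠ m in atTop, ∀ r ∈ Set.Ico m (2 * m), a * r + b ∉ A) :
    ¬ HasAsymptoticDensity A 1 := by
  intro hone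
  have hlength : Tendsto (fun m => a * (2 * m) + b) atTop atTop :=
    tendsto_atTop_mono (fun m => show m ≤ a * (2 * m) + b by nlinarith) tendsto_id
  have hpos : (0 : ℝ) < 2 * a + b := by positivity
  have hdense := (hone.comp hlength).eventually (lt_mem_nhds
    (sub_lt_self 1 (one_div_pos.2 hpos)))
  obtain ⟨m, hm, hlt, hm0⟩ := (hA.and_eventually (hdense.and (eventually_gt_atTop 0))).exists
  have hcard : ((A ∩ Set.Iio (a * (2 * m) + b)).ncard : ℝ) + m ≤ a * (2 * m) + b := by
    exact_mod_cast ncard_inter_Iio_add_le ha hm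
  have hm1 : (1 : ℝ) ≤ m := Nat.one_le_cast.2 hm0
  simp only [Function.comp_apply, Nat.cast_add, Nat.cast_mul, Nat.cast_ofNat] at hlt
  rw [lt_div_iff₀ (by positivity), sub_mul, one_mul, one_div_mul_eq_div] at hlt
  have hshort : (m : ℝ) < (a * (2 * m) + b) / (2 * a + b) := by linarith
  rw [lt_div_iff₀ hpos] at hshort
  nlinarith [(Nat.cast_nonneg b : (0 : ℝ) ≤ b)]

end AsymptoticDensity

section Construction

theorem padicValNat_two_pow_mul_odd (j r : ℕ) : padicValNat 2 (2 ^ j * (2 * r + 1)) = j := by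
  rw [padicValNat.mul (by positivity) (by lia), padicValNat.prime_pow,
    padicValNat.eq_zero_of_not_dvd (by lia), add_zero]

/-- The restraint carried by `k = 2 ^ j * (2 * r + 1)` with `j = ⟨e, i⟩`: it codes whether `j ∈ C`
if `r = 0`, and is the `s`-th restraint `R i s` if `2 ^ s ≤ r < 2 ^ (s + 1)`. -/
def assignedRestraint (R : ℕ → ℕ → Restraint) (k : ℕ) : Restraint :=
  if k / 2 ^ (padicValNat 2 k + 1) = 0 then some [padicValNat 2 k]
  else R (padicValNat 2 k).unpair.2 (Nat.log 2 (k / 2 ^ (padicValNat 2 k + 1)))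

/-- The side on which `k = 2 ^ j * (2 * r + 1)` with `j = ⟨e, i⟩` is released at stage `t`: it is
`2 * k + 1` if by then the `e`-th program has put `2 * k` into the set it computes, and `2 * k`
otherwise. -/
def diagonalSide (k t : ℕ) : Bool :=
  (ofNat Code (padicValNat 2 k).unpair.1).evaln t (2 * k) = some 1

theorem assignedRestraint_two_pow_mul_odd (R : ℕ → ℕ → Restraint) (j r : ℕ) :
    assignedRestraint R (2 ^ j * (2 * r + 1)) =
      if r = 0 then some [j] else R j.unpair.2 (Nat.log 2 r) := by
  have hr : 2 ^ j * (2 * r + 1) / 2 ^ (j + 1) = r := by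
    rw [pow_succ, Nat.mul_div_mul_left _ _ (by positivity)]
    lia
  simp only [assignedRestraint, padicValNat_two_pow_mul_odd, hr]

theorem assignedRestraint_two_pow (R : ℕ → ℕ → Restraint) (j : ℕ) :
    assignedRestraint R (2 ^ j) = some [j] := by
  simpa using assignedRestraint_two_pow_mul_odd R j 0

theorem primrec_assignedRestraint {R : ℕ → ℕ → Restraint} (hR : Primrec₂ R) :
    Primrec (assignedRestraint R) := by
  have hval : Primrec (padicValNat 2) := primrec_padicValNat 2
  have hdiv : Primrec fun k => k / 2 ^ (padicValNat 2 k + 1) :=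
    Primrec.nat_div.comp .id (primrec₂_pow.comp (.const 2) (Primrec.succ.comp hval))
  exact Primrec.ite (Primrec.eq.comp hdiv (.const 0))
    (Primrec.option_some.comp (Primrec.list_cons.comp hval (.const [])))
    (hR.comp (Primrec.snd.comp (Primrec.unpair.comp hval)) ((primrec_log one_lt_two).comp hdiv))

theorem primrec₂_diagonalSide : Primrec₂ diagonalSide := by
  have hcode : Primrec fun k => ofNat Code (padicValNat 2 k).unpair.1 :=
    (Primrec.ofNat Code).comp
      (Primrec.fst.comp (Primrec.unpair.comp (primrec_padicValNat 2)))
  exact (Primrec.eq.comp (Code.primrec_evaln.comp ((Primrec.snd.pair (hcode.comp Primrec.fst)).pair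
    (Primrec.nat_double.comp Primrec.fst))) (Primrec.const (some 1))).decide

variable {C : Set ℕ} {R : ℕ → ℕ → Restraint}

theorem finite_isRespectedBy_assignedRestraint
    (hfin : ∀ i, {s | (R i s).IsRespectedBy C}.Finite) (n : ℕ) :
    {k | (assignedRestraint R k).IsRespectedBy C ∧ ¬ 2 ^ n ∣ k}.Finite := by
  have hlog : ∀ i, {r | r = 0 ∨ (R i (Nat.log 2 r)).IsRespectedBy C}.Finite := fun i =>
    (Set.finite_singleton 0).union ((hfin i).preimage' fun s _ =>
      (Set.finite_Iio (2 ^ (s + 1))).subset fun r hr =>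
        Nat.lt_pow_of_log_lt one_lt_two (Nat.lt_succ_of_le (le_of_eq hr)))
  refine ((Set.finite_Iio n).biUnion fun j _ =>
    (hlog j.unpair.2).image fun r => 2 ^ j * (2 * r + 1)).subset ?_
  rintro k ⟨hk, hdvd⟩
  obtain ⟨j, _, ⟨r, rfl⟩, rfl⟩ := Nat.exists_eq_two_pow_mul_odd
    (show k ≠ 0 from fun hk => hdvd (hk ▸ dvd_zero _))
  have hj : j < n := lt_of_not_ge fun hnj => hdvd ((pow_dvd_pow 2 hnj).mul_right _)
  refine Set.mem_biUnion hj ⟨r, or_iff_not_imp_left.2 fun hr => ?_, rfl⟩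
  rwa [assignedRestraint_two_pow_mul_odd, if_neg hr] at hk

theorem hasAsymptoticDensity_releaseSet (E : StageEnumeration C)
    (hfin : ∀ i, {s | (R i s).IsRespectedBy C}.Finite) (side : ℕ → ℕ → Bool) :
    HasAsymptoticDensity (releaseSet E (assignedRestraint R) side) (1 / 2) := by
  refine hasAsymptoticDensity_half (U := {k | (assignedRestraint R k).IsRespectedBy C})
    (fun k hk => ?_) (fun k hk => ?_) (hasAsymptoticDensity_zero ?_)
  · exact not_or.1 ((Bool.exists_bool.not.1 (exists_bit_mem_releaseSet_iff.not_left.2 hk)))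
  · obtain ⟨t, ht⟩ := exists_isReleasedAt_iff (E := E).2 hk
    have hfalse := ht.bit_mem_releaseSet_iff (side := side) (b := false)
    have htrue := ht.bit_mem_releaseSet_iff (side := side) (b := true)
    rw [Nat.bit_false] at hfalse
    rw [Nat.bit_true] at htrue
    simp [hfalse, htrue]
  · exact (tendsto_pow_atTop_atTop_of_one_lt one_lt_two).frequently
      (.of_forall (finite_isRespectedBy_assignedRestraint hfin))

theorem two_mul_mem_releaseSet_iff_notMem {L : ℕ → Restraint} {D : Set ℕ} {c : Code}
    (hc : ∀ t x, (c.evaln t x).isSome → (c.evaln t x = some 1 ↔ x ∈ D)) {E : StageEnumeration C}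
    {k b : ℕ} (hk : (padicValNat 2 k).unpair.1 = encode c) (hconv : (c.evaln b (2 * k)).isSome)
    (hlate : (L k).IsRespectedBy (E.stage b)) (hviolated : ¬ (L k).IsRespectedBy C) :
    2 * k ∈ releaseSet E L diagonalSide ↔ 2 * k ∉ D := by
  obtain ⟨t, ht⟩ := exists_isReleasedAt_iff.2 hviolated
  have hbt : b ≤ t := le_of_not_ge fun htb => ht.2 (hlate.anti (E.mono htb))
  obtain ⟨y, hy⟩ := Option.isSome_iff_exists.1 hconv
  have hvalue := hc t (2 * k) (Option.isSome_of_mem (Code.evaln_mono hbt hy))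
  have hmem := ht.bit_mem_releaseSet_iff (side := diagonalSide) (b := false)
  rw [Nat.bit_false] at hmem
  rw [hmem, diagonalSide, hk, ofNat_encode, decide_eq_false_iff_not, hvalue]

theorem not_isCoarselyComputable_releaseSet (E : StageEnumeration C)
    (hlate : ∀ h : ℕ → ℕ, Computable h → Monotone h → (∀ s, s ≤ h s) → ∃ i, ∃ᶠ s in atTop,
      (R i s).IsRespectedBy (E.stage (h s)) ∧ ¬ (R i s).IsRespectedBy C) :
    ¬ IsCoarselyComputable (releaseSet E (assignedRestraint R) diagonalSide) := by
  rintro ⟨D, hD, hdensity⟩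
  obtain ⟨c, htotal, hc⟩ := hD.exists_code
  obtain ⟨h, hh, hmono, hle, hconv⟩ := exists_convergence_bound htotal
  obtain ⟨i, hi⟩ := hlate (fun s => h (4 ^ s))
    (hh.comp (primrec₂_pow.comp (.const 4) .id).to_comp)
    (hmono.comp (pow_right_mono₀ (by norm_num)))
    fun s => (Nat.lt_pow_self (by norm_num)).le.trans (hle _)
  let j := Nat.pair (encode c) i
  refine not_hasAsymptoticDensity_one (a := 2 ^ (j + 2)) (b := 2 ^ (j + 1)) (by positivity) ?_
    hdensity
  refine (tendsto_pow_atTop_atTop_of_one_lt (one_lt_two (α := ℕ))).frequently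
    ((hi.and_eventually (eventually_ge_atTop (j + 3))).mono ?_)
  rintro s ⟨⟨hrespected, hviolated⟩, hs⟩ r ⟨hsr, hrs⟩
  have hlog : Nat.log 2 r = s := Nat.log_eq_of_pow_le_of_lt_pow hsr (by rwa [pow_succ'])
  have hr : r ≠ 0 := (Nat.pos_of_neZero (2 ^ s)).trans_le hsr |>.ne'
  have hL : assignedRestraint R (2 ^ j * (2 * r + 1)) = R i s := by
    rw [assignedRestraint_two_pow_mul_odd, if_neg hr, hlog, Nat.unpair_pair]
  have hx : 2 ^ (j + 2) * r + 2 ^ (j + 1) = 2 * (2 ^ j * (2 * r + 1)) := by ring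
  have hinput : 2 * (2 ^ j * (2 * r + 1)) < 4 ^ s := by
    calc 2 * (2 ^ j * (2 * r + 1)) = 2 ^ (j + 1) * (2 * r + 1) := by ring
      _ < 2 ^ (j + 1) * 2 ^ (s + 2) := by gcongr; lia
      _ = 2 ^ (j + 3 + s) := by ring
      _ ≤ 2 ^ (s + s) := pow_le_pow_right₀ one_le_two (by lia)
      _ = 4 ^ s := by rw [← two_mul, pow_mul]; norm_num
  rw [hx, Set.mem_ofPred_eq, two_mul_mem_releaseSet_iff_notMem hc (b := h (4 ^ s))
    (by rw [padicValNat_two_pow_mul_odd, Nat.unpair_pair]) (hconv _ _ hinput) (hL ▸ hrespected)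
    (hL ▸ hviolated)]
  exact not_iff_self

end Construction

/-- Every nonlow c.e. Turing degree contains a c.e. set of asymptotic density `1 / 2` that is not
coarsely computable. -/
theorem theorem4p2 (a : TuringDegree) (hce : IsCEDegree a) (hlow : ¬ IsLowDegree a) :
    ∃ A : Set ℕ, turingDegreeOf A = a ∧ IsCESet A ∧ HasAsymptoticDensity A (1 / 2) ∧
      ¬ IsCoarselyComputable A := by
  obtain ⟨C, rfl, hC⟩ := hce
  obtain ⟨E⟩ := nonempty_stageEnumeration hC
  obtain ⟨R, hR, hjump, hfin⟩ := exists_primrec₂_restraint hC rePred_jumpAxioms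
  have hL := primrec_assignedRestraint hR
  have hpow : Computable fun j : ℕ => 2 ^ j := (primrec₂_pow.comp (.const 2) .id).to_comp
  refine ⟨releaseSet E (assignedRestraint R) diagonalSide,
    turingDegreeOf_releaseSet E hC hL primrec₂_diagonalSide hpow (assignedRestraint_two_pow R),
    isCESet_releaseSet E hL primrec₂_diagonalSide, hasAsymptoticDensity_releaseSet E hfin _,
    not_isCoarselyComputable_releaseSet E fun h hh hmono hle => ?_⟩
  by_contra! hvisible
  obtain ⟨g, hg, hlim⟩ := exists_limit_of_eventually_visible (W := turingJump C) hR hjump E hh hmono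
    hle hvisible
  exact hlow ⟨C, rfl, isLowSet_of_limit hg hlim⟩
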